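/- Let $(M,J)$ be a paracompact Hausdorff smooth manifold of real dimension $2n$ with a smooth almost complex structure $J$. A smooth function $f:U\to\mathbb C$ on an open set $U\subseteq M$ is called almost holomorphic if $J^*df=i\,df$, where $(J^*\omega)(X)=\omega(JX)$. Functions $f_1,\dots,f_k:U\to\mathbb C$ are called functionally independent on $U$ if $df_1,\dots,df_k$ are linearly independent over $\mathbb C$ at every point of $U$. For $0\le m\le n$, a Spencer coordinate system of type $m$ on $U$ is a diffeomorphism $z=(z^1,\dots,z^n)$ of $U$ onto an open subset of $\mathbb C^n\cong\mathbb R^{2n}$ such that $z^1,\dots,z^m$ are almost holomorphic and form, on every nonempty open subset $V\subseteq U$, a maximal sequence of functionally independent almost holomorphic functions (no almost holomorphic function on $V$ can be appended to $z^1|_V,\dots,z^m|_V$ so that the $m+1$ functions are functionally independent on $V$). The functions $z^1,\dots,z^m$ are called its holomorphic coordinates. Assume that $(M,J)$ has constant Spencer type $m$, i.e. every point of $M$ lies in the domain of a Spencer coordinate system of type $m$. Then there exists a locally finite open covering $(U_j)$ of $M$ by domains of Spencer coordinate systems $(U_j;z_j^1,\dots,z_j^n)$ of type $m$ such that for all $j,k$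 the set $W_{jk}=(z_k^1,\dots,z_k^m)(U_j\cap U_k)$ is open in $\mathbb C^m$ and there is a holomorphic map $H_{jk}:W_{jk}\to\mathbb C^m$ with $$(z_j^1,\dots,z_j^m)=H_{jk}(z_k^1,\dots,z_k^m)\quad\text{on } U_j\cap U_k .$$ -/

import Mathlib

open scoped Manifold ContDiff
open Bundle

universe u

noncomputable section

/-- The differential at `x` of a complex valued function on a smooth real manifold,
as a real linear map `T_x M → ℂ`. Such maps form a complex vector space. -/
def cDiff {d : ℕ} {M : Type*} [TopologicalSpace M] [ChartedSpace (EuclideanSpace ℝ (Fin d)) M]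
    (f : M → ℂ) (x : M) : TangentSpace (𝓡 d) x →L[ℝ] ℂ :=
  mfderiv (𝓡 d) 𝓘(ℝ, ℂ) f x

/-- A smooth almost complex structure: a smooth field of endomorphisms of the tangent spaces
(a smooth section of the bundle `End(TM)`) whose square is `-1`. -/
structure AlmostComplexStructure (d : ℕ) (M : Type*) [TopologicalSpace M]
    [ChartedSpace (EuclideanSpace ℝ (Fin d)) M] [IsManifold (𝓡 d) ∞ M] where
  toFun : ∀ x : M, TangentSpace (𝓡 d) x →L[ℝ] TangentSpace (𝓡 d) x
  sq_eq_neg : ∀ (x : M) (v : TangentSpace (𝓡 d) x), toFun x (toFun x v) = -v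
  smooth : ContMDiff (𝓡 d)
    ((𝓡 d).prod 𝓘(ℝ, EuclideanSpace ℝ (Fin d) →L[ℝ] EuclideanSpace ℝ (Fin d))) ∞
    (fun x ↦ TotalSpace.mk' (EuclideanSpace ℝ (Fin d) →L[ℝ] EuclideanSpace ℝ (Fin d))
      (E := fun x : M ↦ TangentSpace (𝓡 d) x →L[ℝ] TangentSpace (𝓡 d) x) x (toFun x))

section

variable {n m : ℕ} {M : Type*} [TopologicalSpace M]
  [ChartedSpace (EuclideanSpace ℝ (Fin (2 * n))) M] [IsManifold (𝓡 (2 * n)) ∞ M]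

/-- `f` is almost holomorphic on `U` (used for open `U`): it is smooth on `U` and
`J^* df = i df` at every point of `U`, where `J^* ω = ω ∘ J`. -/
def IsAlmostHolomorphicOn (J : AlmostComplexStructure (2 * n) M) (f : M → ℂ) (U : Set M) : Prop :=
  ContMDiffOn (𝓡 (2 * n)) 𝓘(ℝ, ℂ) ∞ f U ∧
    ∀ x ∈ U, (cDiff (d := 2 * n) f x).comp (J.toFun x) = Complex.I • cDiff (d := 2 * n) f x

/-- Functional independence on `U` of a finite sequence of complex functions: their differentials
are linearly independent over `ℂ` at every point of `U`. -/
def FunctionallyIndependentOn (n : ℕ) {M : Type*} [TopologicalSpace M]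
    [ChartedSpace (EuclideanSpace ℝ (Fin (2 * n))) M] {k : ℕ} (f : Fin k → M → ℂ)
    (U : Set M) : Prop :=
  ∀ x ∈ U, LinearIndependent ℂ (fun j ↦ cDiff (d := 2 * n) (f j) x)

/-- `(f_1, …, f_k)` is a maximal sequence of functionally independent almost holomorphic functions
on `U`: no almost holomorphic function on `U` can be appended to it. -/
structure IsMaximalAlmostHolomorphicOn (J : AlmostComplexStructure (2 * n) M) {k : ℕ}
    (f : Fin k → M → ℂ) (U : Set M) : Prop where
  almostHolomorphic : ∀ j, IsAlmostHolomorphicOn J (f j) U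
  independent : FunctionallyIndependentOn n f U
  maximal : ∀ g : M → ℂ, IsAlmostHolomorphicOn J g U →
    ¬ FunctionallyIndependentOn n (Fin.snoc (α := fun _ ↦ M → ℂ) f g) U

/-- The first `m` of the `n` complex coordinates `z = (z^1, …, z^n)`. -/
def holCoord (hm : m ≤ n) (z : OpenPartialHomeomorph M (Fin n → ℂ)) (x : M) : Fin m → ℂ :=
  fun j ↦ z x (Fin.castLE hm j)

/-- `z = (z^1, …, z^n)`, defined on the open set `U = z.source`, is a Spencer coordinate system of
type `m`: it is a diffeomorphism of `U` onto an open subset of `ℂ^n = ℝ^{2n}` (so that `z^k` and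
their conjugates are complex self-conjugate coordinates on `U`), and its first `m` coordinates are
a maximal sequence of functionally independent almost holomorphic functions, on `U` and on each
nonempty open subset of `U` (so the number `m` is local and intrinsic). -/
structure IsSpencerChart (J : AlmostComplexStructure (2 * n) M) (hm : m ≤ n)
    (z : OpenPartialHomeomorph M (Fin n → ℂ)) : Prop where
  smooth : ContMDiffOn (𝓡 (2 * n)) 𝓘(ℝ, Fin n → ℂ) ∞ z z.source
  smooth_symm : ContMDiffOn 𝓘(ℝ, Fin n → ℂ) (𝓡 (2 * n)) ∞ z.symm z.target
  almostHolomorphic : ∀ j, IsAlmostHolomorphicOn J (fun x ↦ holCoord hm z x j) z.source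
  maximal : ∀ V : Set M, IsOpen V → V.Nonempty → V ⊆ z.source →
    IsMaximalAlmostHolomorphicOn J (fun (j : Fin m) x ↦ holCoord hm z x j) V

/-- `(M, J)` has constant Spencer type `m`: Spencer coordinate systems of type `m` cover `M`. -/
def HasSpencerType (J : AlmostComplexStructure (2 * n) M) (hm : m ≤ n) : Prop :=
  ∀ p : M, ∃ z : OpenPartialHomeomorph M (Fin n → ℂ), IsSpencerChart J hm z ∧ p ∈ z.source

end

end

/-! Let `z`, `z'` be overlapping Spencer charts. Maximality puts each d`z'`^j, j ≤ m, in the span of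
d`z`^1, …, d`z`^m: the set where this fails is open, and on it z'^j could be appended. Read in the
chart `z`, z'^j then has a complex linear differential that kills the last n - m directions, so on a
ball it is a holomorphic function of the first m coordinates
(`exists_holomorphic_factor_of_fderiv_mem`).

This is only local: the fibres of (z^1, …, z^m) in an overlap may be disconnected, so one map need
not serve the whole overlap. The cover is therefore made so fine that any two meeting members both
lie in the domain of a third chart, with whose holomorphic coordinates theirs correspond through a
single holomorphic map each way. Composing through that chart gives the transition. -/

open scoped Topology

/-! ### Functions of the first m coordinates on ℂ^n. -/

section

variable {n m : ℕ}

/-- The projection of `ℂ^n` onto its first `m` coordinates. -/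
noncomputable def firstCoords (hm : m ≤ n) : (Fin n → ℂ) →L[ℂ] (Fin m → ℂ) :=
  ContinuousLinearMap.pi fun j ↦ ContinuousLinearMap.proj (Fin.castLE hm j)

@[simp]
theorem firstCoords_apply (hm : m ≤ n) (y : Fin n → ℂ) (j : Fin m) :
    firstCoords hm y j = y (Fin.castLE hm j) := rfl

/-- Overwrites the first `m` coordinates of a vector `y` of `ℂ^n`. -/
def overwriteFirst (n : ℕ) (y : Fin n → ℂ) (u : Fin m → ℂ) : Fin n → ℂ :=
  fun i ↦ if h : (i : ℕ) < m then u ⟨i, h⟩ else y i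

theorem firstCoords_overwriteFirst (hm : m ≤ n) (y : Fin n → ℂ) (u : Fin m → ℂ) :
    firstCoords hm (overwriteFirst n y u) = u := by
  ext j
  simp [overwriteFirst]

theorem differentiable_overwriteFirst (y : Fin n → ℂ) :
    Differentiable ℂ (overwriteFirst n y : (Fin m → ℂ) → _) := by
  refine differentiable_pi.2 fun i ↦ ?_
  by_cases h : (i : ℕ) < m
  · simp only [overwriteFirst, h, dite_true]
    fun_prop
  · simp only [overwriteFirst, h, dite_false]
    fun_prop

/-- The norm is the sup norm, so balls are polydiscs and the condition is coordinatewise. -/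
theorem overwriteFirst_mem_ball (hm : m ≤ n) {y₀ : Fin n → ℂ} {u : Fin m → ℂ} {r : ℝ}
    (hr : 0 < r) (hu : u ∈ Metric.ball (firstCoords hm y₀) r) :
    overwriteFirst n y₀ u ∈ Metric.ball y₀ r := by
  rw [Metric.mem_ball, dist_pi_lt_iff hr] at hu ⊢
  intro i
  by_cases h : (i : ℕ) < m
  · simpa [overwriteFirst, h] using hu ⟨i, h⟩
  · simpa [overwriteFirst, h] using hr

theorem firstCoords_mem_ball (hm : m ≤ n) {y₀ y : Fin n → ℂ} {r : ℝ}
    (hr : 0 < r) (hy : y ∈ Metric.ball y₀ r) :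
    firstCoords hm y ∈ Metric.ball (firstCoords hm y₀) r := by
  rw [Metric.mem_ball, dist_pi_lt_iff hr] at hy ⊢
  exact fun j ↦ hy _

theorem isOpenMap_firstCoords (hm : m ≤ n) : IsOpenMap (firstCoords hm) :=
  (firstCoords hm).isOpenMap fun u ↦ ⟨overwriteFirst n 0 u, firstCoords_overwriteFirst hm 0 u⟩

/-- The `ℂ`-span of the differentials of the first `m` coordinates of `ℂ^n`. -/
noncomputable def firstCoordsSpan (hm : m ≤ n) : Submodule ℂ ((Fin n → ℂ) →L[ℝ] ℂ) :=
  Submodule.span ℂ (Set.range fun j : Fin m ↦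
    (ContinuousLinearMap.proj (R := ℝ) (φ := fun _ : Fin n ↦ ℂ) (Fin.castLE hm j)))

/-- Makes failure of membership an open condition on the point, as maximality is tested on open
sets. -/
theorem isClosed_firstCoordsSpan (hm : m ≤ n) :
    IsClosed (firstCoordsSpan hm : Set ((Fin n → ℂ) →L[ℝ] ℂ)) := by
  have : FiniteDimensional ℂ (firstCoordsSpan hm) :=
    FiniteDimensional.span_of_finite ℂ (Set.finite_range _)
  exact (firstCoordsSpan hm).closed_of_finiteDimensional

theorem eq_zero_of_mem_firstCoordsSpan (hm : m ≤ n) {L : (Fin n → ℂ) →L[ℝ] ℂ}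
    (hL : L ∈ firstCoordsSpan hm) {v : Fin n → ℂ} (hv : firstCoords hm v = 0) : L v = 0 := by
  induction hL using Submodule.span_induction with
  | mem L h => obtain ⟨j, rfl⟩ := h; exact congrFun hv j
  | zero => rfl
  | add L L' _ _ h h' => simp [h, h']
  | smul c L _ h => simp [h]

theorem map_smul_of_mem_firstCoordsSpan (hm : m ≤ n) {L : (Fin n → ℂ) →L[ℝ] ℂ}
    (hL : L ∈ firstCoordsSpan hm) (c : ℂ) (v : Fin n → ℂ) : L (c • v) = c • L v := by
  induction hL using Submodule.span_induction with
  | mem L h => obtain ⟨j, rfl⟩ := h; rfl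
  | zero => simp
  | add L L' _ _ h h' => simp only [add_apply, h, h', smul_add]
  | smul a L _ h => simp only [smul_apply, h, smul_comm a c]

/-- A function on a ball of `ℂ^n` whose differential is a combination of `dz^1, …, dz^m` is a
holomorphic function of `z^1, …, z^m`. -/
theorem exists_holomorphic_factor_of_fderiv_mem (hm : m ≤ n) {f : (Fin n → ℂ) → ℂ}
    {y₀ : Fin n → ℂ} {r : ℝ} (hr : 0 < r)
    (hf : ∀ y ∈ Metric.ball y₀ r, DifferentiableAt ℝ f y)
    (hspan : ∀ y ∈ Metric.ball y₀ r, fderiv ℝ f y ∈ firstCoordsSpan hm) :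
    ∃ h : (Fin m → ℂ) → ℂ, DifferentiableOn ℂ h (Metric.ball (firstCoords hm y₀) r) ∧
      ∀ y ∈ Metric.ball y₀ r, f y = h (firstCoords hm y) := by
  have hfC : ∀ y ∈ Metric.ball y₀ r, DifferentiableAt ℂ f y := by
    intro y hy
    rw [differentiableAt_iff_restrictScalars ℝ (hf y hy)]
    refine ⟨⟨⟨⟨fderiv ℝ f y, map_add _⟩, map_smul_of_mem_firstCoordsSpan hm (hspan y hy)⟩,
      (fderiv ℝ f y).cont⟩, rfl⟩
  refine ⟨fun u ↦ f (overwriteFirst n y₀ u), fun u hu ↦ ?_, fun y hy ↦ ?_⟩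
  · exact ((hfC _ (overwriteFirst_mem_ball hm hr hu)).comp u
      (differentiable_overwriteFirst y₀ u)).differentiableWithinAt
  -- `y` and `y'` have the same first m coordinates; `f` is constant on the segment between them,
  -- which stays in the convex ball.
  · set y' := overwriteFirst n y₀ (firstCoords hm y) with hy'
    have hy'mem : y' ∈ Metric.ball y₀ r :=
      overwriteFirst_mem_ball hm hr (firstCoords_mem_ball hm hr hy)
    have hv : firstCoords hm (y - y') = 0 := by
      rw [map_sub, hy', firstCoords_overwriteFirst, sub_self]
    have hseg : ∀ t ∈ Set.Icc (0 : ℝ) 1, AffineMap.lineMap y' y t ∈ Metric.ball y₀ r :=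
      fun t ht ↦ (convex_ball y₀ r).lineMap_mem hy'mem hy ht
    have hd : ∀ t ∈ Set.Icc (0 : ℝ) 1,
        HasDerivAt (fun t : ℝ ↦ f (AffineMap.lineMap y' y t)) 0 t := by
      intro t ht
      have := (hf _ (hseg t ht)).hasFDerivAt.comp_hasDerivAt t
        (AffineMap.hasDerivAt_lineMap (a := y') (b := y) (x := t))
      rwa [eq_zero_of_mem_firstCoordsSpan hm (hspan _ (hseg t ht)) hv] at this
    have := constant_of_has_deriv_right_zero
      (fun t ht ↦ (hd t ht).continuousAt.continuousWithinAt)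
      (fun t ht ↦ (hd t (Set.Ico_subset_Icc_self ht)).hasDerivWithinAt) 1 (by simp)
    simpa using this

end

/-! ### Holomorphic dependence of one map on another. -/

section

variable {m : ℕ} {M : Type*}

/-- On `N`, the map `g` is a holomorphic function of `f`. -/
def FactorsHolomorphicallyOn (f g : M → Fin m → ℂ) (N : Set M) : Prop :=
  ∃ h : (Fin m → ℂ) → (Fin m → ℂ), DifferentiableOn ℂ h (f '' N) ∧ ∀ x ∈ N, g x = h (f x)

theorem FactorsHolomorphicallyOn.mono {f g : M → Fin m → ℂ} {N N' : Set M}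
    (h : FactorsHolomorphicallyOn f g N) (hN : N' ⊆ N) : FactorsHolomorphicallyOn f g N' := by
  obtain ⟨h, hd, he⟩ := h
  exact ⟨h, hd.mono (Set.image_mono hN), fun x hx ↦ he x (hN hx)⟩

theorem FactorsHolomorphicallyOn.trans {f g k : M → Fin m → ℂ} {N : Set M}
    (hfg : FactorsHolomorphicallyOn f g N) (hgk : FactorsHolomorphicallyOn g k N) :
    FactorsHolomorphicallyOn f k N := by
  obtain ⟨h, hd, he⟩ := hfg
  obtain ⟨h', hd', he'⟩ := hgk
  refine ⟨h' ∘ h, hd'.comp hd ?_, fun x hx ↦ by rw [he' x hx, he x hx, Function.comp_apply]⟩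
  rintro _ ⟨x, hx, rfl⟩
  exact ⟨x, hx, he x hx⟩

end

/-! ### Local comparison of Spencer charts. -/

section

variable {n m : ℕ} {M : Type*} [TopologicalSpace M]

theorem isOpen_holCoord_image (hm : m ≤ n) (z : OpenPartialHomeomorph M (Fin n → ℂ)) {S : Set M}
    (hS : IsOpen S) (hSz : S ⊆ z.source) : IsOpen (holCoord hm z '' S) := by
  have h : holCoord hm z '' S = firstCoords hm '' (z '' S) := by
    rw [Set.image_image]; rfl
  rw [h]
  exact isOpenMap_firstCoords hm _ (z.isOpen_image_of_subset_source hS hSz)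

variable [ChartedSpace (EuclideanSpace ℝ (Fin (2 * n))) M]

/-- A diffeomorphism onto an open subset of a model vector space has an onto differential. -/
theorem surjective_mfderiv_of_smooth_symm {z : OpenPartialHomeomorph M (Fin n → ℂ)}
    (hz : ContMDiffOn (𝓡 (2 * n)) 𝓘(ℝ, Fin n → ℂ) ∞ z z.source)
    (hz' : ContMDiffOn 𝓘(ℝ, Fin n → ℂ) (𝓡 (2 * n)) ∞ z.symm z.target)
    {x : M} (hx : x ∈ z.source) :
    Function.Surjective (mfderiv (𝓡 (2 * n)) 𝓘(ℝ, Fin n → ℂ) z x) := by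
  have h1 : MDifferentiableAt (𝓡 (2 * n)) 𝓘(ℝ, Fin n → ℂ) z (z.symm (z x)) := by
    rw [z.left_inv hx]
    exact (hz.contMDiffAt (z.open_source.mem_nhds hx)).mdifferentiableAt (by simp)
  have h2 : MDifferentiableAt 𝓘(ℝ, Fin n → ℂ) (𝓡 (2 * n)) z.symm (z x) :=
    (hz'.contMDiffAt (z.open_target.mem_nhds (z.map_source hx))).mdifferentiableAt (by simp)
  have h3 := mfderiv_comp (z x) h1 h2
  have h4 : (z ∘ z.symm) =ᶠ[𝓝 (z x)] id := z.eventually_right_inverse (z.map_source hx)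
  rw [h4.mfderiv_eq, mfderiv_id, z.left_inv hx] at h3
  intro w
  exact ⟨_, (DFunLike.congr_fun h3 w).symm⟩

theorem cDiff_comp_chart {z : OpenPartialHomeomorph M (Fin n → ℂ)}
    (hz : ContMDiffOn (𝓡 (2 * n)) 𝓘(ℝ, Fin n → ℂ) ∞ z z.source)
    {x : M} (hx : x ∈ z.source) {f : (Fin n → ℂ) → ℂ} (hf : DifferentiableAt ℝ f (z x)) :
    cDiff (d := 2 * n) (fun x ↦ f (z x)) x =
      (fderiv ℝ f (z x)).comp (mfderiv (𝓡 (2 * n)) 𝓘(ℝ, Fin n → ℂ) z x) := by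
  have h1 : MDifferentiableAt (𝓡 (2 * n)) 𝓘(ℝ, Fin n → ℂ) z x :=
    (hz.contMDiffAt (z.open_source.mem_nhds hx)).mdifferentiableAt (by simp)
  have h2 := mfderiv_comp x hf.mdifferentiableAt h1
  rw [mfderiv_eq_fderiv] at h2
  exact h2

variable [IsManifold (𝓡 (2 * n)) ∞ M] {J : AlmostComplexStructure (2 * n) M}

theorem IsAlmostHolomorphicOn.mono {f : M → ℂ} {U V : Set M}
    (h : IsAlmostHolomorphicOn J f U) (hVU : V ⊆ U) : IsAlmostHolomorphicOn J f V :=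
  ⟨h.1.mono hVU, fun x hx ↦ h.2 x (hVU hx)⟩

namespace IsSpencerChart

variable {hm : m ≤ n} {z z' : OpenPartialHomeomorph M (Fin n → ℂ)}

theorem restrOpen (hz : IsSpencerChart J hm z) {s : Set M} (hs : IsOpen s) :
    IsSpencerChart J hm (z.restrOpen s hs) where
  smooth := hz.smooth.mono Set.inter_subset_left
  smooth_symm := hz.smooth_symm.mono Set.inter_subset_left
  almostHolomorphic j := (hz.almostHolomorphic j).mono Set.inter_subset_left
  maximal V hV hne hVs := hz.maximal V hV hne (hVs.trans Set.inter_subset_left)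

theorem contDiffOn_transition (hz : IsSpencerChart J hm z) (hz' : IsSpencerChart J hm z')
    (j : Fin m) : ContDiffOn ℝ ∞ (fun y ↦ holCoord hm z' (z.symm y) j)
      (z.target ∩ z.symm ⁻¹' z'.source) := by
  rw [← contMDiffOn_iff_contDiffOn]
  exact (hz'.almostHolomorphic j).1.comp (hz.smooth_symm.mono Set.inter_subset_left)
    fun y hy ↦ hy.2

/-- By maximality, the differentials of the holomorphic coordinates of one Spencer chart are
combinations of those of another. -/
theorem fderiv_transition_mem_firstCoordsSpan (hz : IsSpencerChart J hm z)
    (hz' : IsSpencerChart J hm z') (j : Fin m) {y₀ : Fin n → ℂ}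
    (hy₀ : y₀ ∈ z.target ∩ z.symm ⁻¹' z'.source) :
    fderiv ℝ (fun y ↦ holCoord hm z' (z.symm y) j) y₀ ∈ firstCoordsSpan hm := by
  by_contra hnot
  set f : (Fin n → ℂ) → ℂ := fun y ↦ holCoord hm z' (z.symm y) j with hf
  set O := z.target ∩ z.symm ⁻¹' z'.source with hO
  have hOo : IsOpen O := z.symm.isOpen_inter_preimage z'.open_source
  have hfO : ContDiffOn ℝ ∞ f O := contDiffOn_transition hz hz' j
  -- The bad set, open since `fderiv ℝ f` is continuous and the span is closed.
  set T := O ∩ fderiv ℝ f ⁻¹' (firstCoordsSpan hm : Set _)ᶜ with hT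
  have hTo : IsOpen T := (hfO.continuousOn_fderiv_of_isOpen hOo (by simp)).isOpen_inter_preimage hOo
    (isClosed_firstCoordsSpan hm).isOpen_compl
  set V := z.source ∩ z ⁻¹' T with hV
  have hVo : IsOpen V := z.isOpen_inter_preimage hTo
  have hVne : V.Nonempty := ⟨z.symm y₀, z.map_target hy₀.1, by
    rw [Set.mem_preimage, z.right_inv hy₀.1]; exact ⟨hy₀, hnot⟩⟩
  have hmax := hz.maximal V hVo hVne Set.inter_subset_left
  have hVz' : V ⊆ z'.source := fun x hx ↦ by
    have := hx.2.1.2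
    rwa [Set.mem_preimage, z.left_inv hx.1] at this
  refine hmax.maximal _ ((hz'.almostHolomorphic j).mono hVz') fun x hx ↦ ?_
  have hA := surjective_mfderiv_of_smooth_symm hz.smooth hz.smooth_symm hx.1
  set A := mfderiv (𝓡 (2 * n)) 𝓘(ℝ, Fin n → ℂ) z x with hAdef
  have hfx : DifferentiableAt ℝ f (z x) :=
    (hfO.contDiffAt (hOo.mem_nhds hx.2.1)).differentiableAt (by simp)
  have hcoord (b : Fin m) : cDiff (d := 2 * n) (fun x ↦ holCoord hm z x b) x =
      (ContinuousLinearMap.proj (R := ℝ) (φ := fun _ : Fin n ↦ ℂ) (Fin.castLE hm b)).comp A := by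
    have := cDiff_comp_chart hz.smooth hx.1 (ContinuousLinearMap.proj (R := ℝ)
      (φ := fun _ : Fin n ↦ ℂ) (Fin.castLE hm b)).differentiableAt
    rw [ContinuousLinearMap.fderiv] at this
    exact this
  have hz'j : cDiff (d := 2 * n) (fun x ↦ holCoord hm z' x j) x = (fderiv ℝ f (z x)).comp A := by
    rw [← cDiff_comp_chart hz.smooth hx.1 hfx]
    refine Filter.EventuallyEq.mfderiv_eq ?_
    filter_upwards [z.open_source.mem_nhds hx.1] with x' hx'
    simp [hf, z.left_inv hx']
  let pull : ((Fin n → ℂ) →L[ℝ] ℂ) →ₗ[ℂ] (TangentSpace (𝓡 (2 * n)) x →L[ℝ] ℂ) :=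
    { toFun L := L.comp A
      map_add' _ _ := rfl
      map_smul' _ _ := rfl }
  -- Injectivity, from surjectivity of `A`, carries membership in the span on the tangent space back
  -- to ℂ^n.
  have hpull : Function.Injective pull := fun L L' h ↦ by
    ext1 w
    obtain ⟨v, rfl⟩ := hA w
    exact DFunLike.congr_fun h v
  have key : LinearIndependent ℂ (Fin.snoc (α := fun _ ↦ TangentSpace (𝓡 (2 * n)) x →L[ℝ] ℂ)
      (fun b ↦ cDiff (d := 2 * n) (fun x ↦ holCoord hm z x b) x)
      (cDiff (d := 2 * n) (fun x ↦ holCoord hm z' x j) x)) := by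
    refine linearIndependent_finSnoc.2 ⟨hmax.independent x hx, fun hmem ↦ hx.2.2 ?_⟩
    have hr : Set.range (fun b ↦ cDiff (d := 2 * n) (fun x ↦ holCoord hm z x b) x) =
        pull '' Set.range fun j : Fin m ↦ (ContinuousLinearMap.proj (R := ℝ)
          (φ := fun _ : Fin n ↦ ℂ) (Fin.castLE hm j)) := by
      rw [← Set.range_comp]
      exact congrArg Set.range (funext hcoord)
    rw [hr, Submodule.span_image, hz'j] at hmem
    obtain ⟨L, hL, hLe⟩ := hmem
    rw [← hpull hLe]
    exact hL
  convert key using 1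
  funext i
  refine Fin.lastCases ?_ (fun i ↦ ?_) i <;> simp

end IsSpencerChart

/-- Near a common point, the holomorphic coordinates of a Spencer chart are holomorphic functions
of those of another. -/
theorem IsSpencerChart.exists_factorsHolomorphicallyOn {hm : m ≤ n}
    {z z' : OpenPartialHomeomorph M (Fin n → ℂ)} (hz : IsSpencerChart J hm z)
    (hz' : IsSpencerChart J hm z') {p : M} (hp : p ∈ z.source) (hp' : p ∈ z'.source) :
    ∃ N ∈ 𝓝 p, FactorsHolomorphicallyOn (holCoord hm z) (holCoord hm z') N := by
  have hOo : IsOpen (z.target ∩ z.symm ⁻¹' z'.source) :=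
    z.symm.isOpen_inter_preimage z'.open_source
  have hpO : z p ∈ z.target ∩ z.symm ⁻¹' z'.source :=
    ⟨z.map_source hp, by rwa [Set.mem_preimage, z.left_inv hp]⟩
  obtain ⟨r, hr, hball⟩ := Metric.isOpen_iff.1 hOo _ hpO
  choose h hd he using fun j ↦ exists_holomorphic_factor_of_fderiv_mem hm hr
    (fun y hy ↦ ((hz.contDiffOn_transition hz' j).contDiffAt
      (hOo.mem_nhds (hball hy))).differentiableAt (by simp))
    (fun y hy ↦ hz.fderiv_transition_mem_firstCoordsSpan hz' j (hball hy))
  refine ⟨z.source ∩ z ⁻¹' Metric.ball (z p) r,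
    (z.isOpen_inter_preimage Metric.isOpen_ball).mem_nhds ⟨hp, Metric.mem_ball_self hr⟩,
    fun u j ↦ h j u, ?_, fun x hx ↦ ?_⟩
  · refine (differentiableOn_pi.2 hd).mono ?_
    rintro _ ⟨x, hx, rfl⟩
    exact firstCoords_mem_ball hm hr hx.2
  · funext j
    have := he j (z x) hx.2
    rw [z.left_inv hx.1] at this
    exact this

end

/-! ### From local to global: choice of the covering. -/

theorem proposition2 {n m : ℕ} (hm : m ≤ n) {M : Type u} [TopologicalSpace M] [T2Space M]
    [ParacompactSpace M] [ChartedSpace (EuclideanSpace ℝ (Fin (2 * n))) M]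
    [IsManifold (𝓡 (2 * n)) ∞ M] (J : AlmostComplexStructure (2 * n) M)
    (hJ : HasSpencerType J hm) :
    ∃ (ι : Type u) (z : ι → OpenPartialHomeomorph M (Fin n → ℂ)),
      (∀ j, IsSpencerChart J hm (z j)) ∧
      LocallyFinite (fun j ↦ (z j).source) ∧
      (⋃ j, (z j).source) = Set.univ ∧
      ∀ j k, IsOpen (holCoord hm (z k) '' ((z j).source ∩ (z k).source)) ∧
        ∃ H : (Fin m → ℂ) → (Fin m → ℂ),
          DifferentiableOn ℂ H (holCoord hm (z k) '' ((z j).source ∩ (z k).source)) ∧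
          ∀ x ∈ (z j).source ∩ (z k).source, holCoord hm (z j) x = H (holCoord hm (z k) x) := by
  choose w hw hmem using hJ
  obtain ⟨V, hVo, hVcov, hVlf, hVw⟩ := precise_refinement (fun p ↦ (w p).source)
    (fun p ↦ (w p).open_source) (Set.eq_univ_of_forall fun p ↦ Set.mem_iUnion.2 ⟨p, hmem p⟩)
  -- Shrinking keeps each closure inside its chart domain, so charts can be compared at closure
  -- points too.
  obtain ⟨W, hWcov, hWo, hWV⟩ := exists_iUnion_eq_closure_subset hVo
    (fun x ↦ hVlf.point_finite x) hVcov
  have hWlf : LocallyFinite fun a ↦ closure (W a) := hVlf.subset hWV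
  have hcw (a : M) : closure (W a) ⊆ (w a).source := (hWV a).trans (hVw a)
  choose α hα using fun p ↦ Set.mem_iUnion.1 (hWcov.symm ▸ Set.mem_univ p : p ∈ ⋃ a, W a)
  have hαw (p : M) : p ∈ (w (α p)).source := hcw _ (subset_closure (hα p))
  have hnhds (p : M) : ∃ N : Set M, IsOpen N ∧ p ∈ N ∧ ∀ a, (N ∩ W a).Nonempty →
      FactorsHolomorphicallyOn (holCoord hm (w a)) (holCoord hm (w (α p))) N ∧
      FactorsHolomorphicallyOn (holCoord hm (w (α p))) (holCoord hm (w a)) N := by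
    choose! A hA hAf using fun a (ha : p ∈ closure (W a)) ↦
      (hw a).exists_factorsHolomorphicallyOn (hw (α p)) (hcw a ha) (hαw p)
    choose! B hB hBf using fun a (ha : p ∈ closure (W a)) ↦
      (hw (α p)).exists_factorsHolomorphicallyOn (hw a) (hαw p) (hcw a ha)
    -- Local finiteness leaves finitely many closures through `p`; `N` will also avoid all the
    -- others.
    have hfin : (⋂ a ∈ {a | p ∈ closure (W a)}, A a ∩ B a) ∈ 𝓝 p :=
      (Filter.biInter_mem (hWlf.point_finite p)).2 fun a ha ↦ Filter.inter_mem (hA a ha) (hB a ha)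
    obtain ⟨N, hN, hNo, hpN⟩ := mem_nhds_iff.1
      (Filter.inter_mem hfin (hWlf.iInter_compl_mem_nhds (fun _ ↦ isClosed_closure) p))
    refine ⟨N, hNo, hpN, fun a ⟨x, hxN, hxa⟩ ↦ ?_⟩
    have ha : p ∈ closure (W a) := by
      by_contra ha
      exact Set.mem_iInter₂.1 (hN hxN).2 a ha (subset_closure hxa)
    have hNAB : N ⊆ A a ∩ B a := fun y hy ↦ Set.mem_iInter₂.1 (hN hy).1 a ha
    exact ⟨(hAf a ha).mono (hNAB.trans Set.inter_subset_left),
      (hBf a ha).mono (hNAB.trans Set.inter_subset_right)⟩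
  choose N hNo hpN hNf using hnhds
  obtain ⟨U, hUo, hUcov, hUlf, hUN⟩ := precise_refinement (fun p ↦ N p ∩ (w (α p)).source)
    (fun p ↦ (hNo p).inter (w (α p)).open_source)
    (Set.eq_univ_of_forall fun p ↦ Set.mem_iUnion.2 ⟨p, hpN p, hαw p⟩)
  have hsource (p : M) : ((w (α p)).restrOpen (U p) (hUo p)).source = U p := by
    rw [OpenPartialHomeomorph.restrOpen_source]
    exact Set.inter_eq_right.2 ((hUN p).trans Set.inter_subset_right)
  refine ⟨M, fun p ↦ (w (α p)).restrOpen (U p) (hUo p), fun p ↦ (hw (α p)).restrOpen (hUo p),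
    by simpa only [hsource] using hUlf, by simpa only [hsource] using hUcov, fun p q ↦ ⟨?_, ?_⟩⟩
  · exact isOpen_holCoord_image hm _
      (OpenPartialHomeomorph.open_source _ |>.inter (OpenPartialHomeomorph.open_source _))
      Set.inter_subset_right
  · simp only [hsource]
    change FactorsHolomorphicallyOn (holCoord hm (w (α q))) (holCoord hm (w (α p))) (U p ∩ U q)
    obtain hempty | ⟨x, hxp, hxq⟩ := (U p ∩ U q).eq_empty_or_nonempty
    · rw [hempty]
      exact ⟨id, differentiableOn_id, fun _ h ↦ h.elim⟩
    -- The intermediate chart is `w (α x)`: since `x` lies in `W (α x)`, that set meets both `N p`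
    -- and `N q`.
    · have hNp := (hNf p (α x) ⟨x, (hUN p hxp).1, hα x⟩).1
      have hNq := (hNf q (α x) ⟨x, (hUN q hxq).1, hα x⟩).2
      exact (hNq.mono fun y hy ↦ (hUN q hy.2).1).trans (hNp.mono fun y hy ↦ (hUN p hy.1).1)
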